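/- Let $d_1, h, k_1$ be real numbers and consider the linear differential equation $u''+a(x)u'+b(x)u=0$ of the Hess case of the motion of a heavy rigid body with a fixed point, where $$a(x)=\frac{d_1x^9-4k_1x^6-4d_1(h^2-1)x^5+12k_1hx^4-8k_1^2d_1x^3-8k_1(h^2-1)x^2-4k_1^3}{x\left(x^6-4hx^4+4(h^2-1)x^2+4k_1^2\right)\left(d_1x^3-k_1\right)},$$ $$b(x)=\frac{(d_1x^3+k_1)(d_1x^3-k_1)}{x^2\left(x^6-4hx^4+4(h^2-1)x^2+4k_1^2\right)}.$$ The substitution $y=u\exp\left(\frac12\int a\,dx\right)$ brings it to the form $y''=R(x)y$ with $R=\frac12a'+\frac14a^2-b$. Suppose that $d_1=0$ (the Lagrange case), that $k_1\ne0$, and that the six complex roots of the polynomial $x^6-4hx^4+4(h^2-1)x^2+4k_1^2$ are distinct. Then the equation $y''=Ry$ has no liouvillian solution of type 1, that is, no solution of the form $\eta=\exp\left(\int\omega\,dx\right)$ with $\omega\in\mathbb{C}(x)$ (here: a nonzero element $\eta$ of a differential field extension of $\mathbb{C}(x)$ with $\eta'=\omega\eta$ and $\eta''=R\eta$). Moreover,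 the Riccati equation $\omega'+\omega^2=R$ has no solution $\omega\in\mathbb{C}(x)$. -/

import Mathlib

universe u

open Polynomial
open scoped Differential

namespace HessTop

noncomputable section

/-- The derivative `d/dx` of a rational function, by the quotient rule. -/
def ratDeriv (f : RatFunc ℂ) : RatFunc ℂ :=
  algebraMap ℂ[X] (RatFunc ℂ)
      (derivative f.num * f.denom - f.num * derivative f.denom) /
    algebraMap ℂ[X] (RatFunc ℂ) f.denom ^ 2

/-- The quotient rule holds for every presentation of a rational function as a fraction. -/
theorem ratDeriv_div (p q : ℂ[X]) (hq : q ≠ 0) :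
    ratDeriv (algebraMap ℂ[X] (RatFunc ℂ) p / algebraMap ℂ[X] (RatFunc ℂ) q) =
      algebraMap ℂ[X] (RatFunc ℂ) (derivative p * q - p * derivative q) /
        algebraMap ℂ[X] (RatFunc ℂ) q ^ 2 := by
  obtain ⟨f, hf⟩ : ∃ f : RatFunc ℂ,
      f = algebraMap ℂ[X] (RatFunc ℂ) p / algebraMap ℂ[X] (RatFunc ℂ) q := ⟨_, rfl⟩
  rw [← hf]
  have hd : f.denom ≠ 0 := f.denom_ne_zero
  have hq' : algebraMap ℂ[X] (RatFunc ℂ) q ≠ 0 := RatFunc.algebraMap_ne_zero hq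
  have hd' : algebraMap ℂ[X] (RatFunc ℂ) f.denom ≠ 0 := RatFunc.algebraMap_ne_zero hd
  have h1 : f.num * q = p * f.denom := by
    apply RatFunc.algebraMap_injective ℂ
    rw [map_mul, map_mul, ← div_eq_div_iff hd' hq', RatFunc.num_div_denom, hf]
  have h3 : derivative f.num * q + f.num * derivative q =
      derivative p * f.denom + p * derivative f.denom := by
    have := congrArg derivative h1
    simpa only [derivative_mul] using this
  have h4 : (derivative f.num * f.denom - f.num * derivative f.denom) * q ^ 2 =
      (derivative p * q - p * derivative q) * f.denom ^ 2 := by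
    linear_combination (f.denom * q) * h3 -
      (derivative q * f.denom + derivative f.denom * q) * h1
  rw [ratDeriv, div_eq_div_iff (pow_ne_zero 2 hd') (pow_ne_zero 2 hq'),
    ← map_pow, ← map_pow, ← map_mul, ← map_mul, h4]

theorem exists_frac (f : RatFunc ℂ) : ∃ p q : ℂ[X], q ≠ 0 ∧
    f = algebraMap ℂ[X] (RatFunc ℂ) p / algebraMap ℂ[X] (RatFunc ℂ) q :=
  ⟨f.num, f.denom, f.denom_ne_zero, (RatFunc.num_div_denom f).symm⟩

theorem ratDeriv_add (f g : RatFunc ℂ) : ratDeriv (f + g) = ratDeriv f + ratDeriv g := by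
  obtain ⟨p, q, hq, rfl⟩ := exists_frac f
  obtain ⟨r, s, hs, rfl⟩ := exists_frac g
  have hq' := RatFunc.algebraMap_ne_zero hq
  have hs' := RatFunc.algebraMap_ne_zero hs
  rw [div_add_div _ _ hq' hs', ← map_mul, ← map_mul, ← map_mul, ← map_add,
    ratDeriv_div _ _ (mul_ne_zero hq hs), ratDeriv_div _ _ hq, ratDeriv_div _ _ hs]
  simp only [derivative_mul, map_add, map_sub, map_mul]
  field_simp
  ring

theorem ratDeriv_mul (f g : RatFunc ℂ) :
    ratDeriv (f * g) = f * ratDeriv g + g * ratDeriv f := by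
  obtain ⟨p, q, hq, rfl⟩ := exists_frac f
  obtain ⟨r, s, hs, rfl⟩ := exists_frac g
  have hq' := RatFunc.algebraMap_ne_zero hq
  have hs' := RatFunc.algebraMap_ne_zero hs
  rw [div_mul_div_comm, ← map_mul, ← map_mul,
    ratDeriv_div _ _ (mul_ne_zero hq hs), ratDeriv_div _ _ hq, ratDeriv_div _ _ hs]
  simp only [derivative_mul, map_add, map_sub, map_mul]
  field_simp
  ring

/-- A differential ring from an additive map that satisfies the Leibniz rule. -/
abbrev differentialOf {A : Type*} [CommRing A] (D : A → A)
    (hadd : ∀ f g, D (f + g) = D f + D g)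
    (hmul : ∀ f g, D (f * g) = f * D g + g * D f) : Differential A where
  deriv := Derivation.mk' (AddMonoidHom.mk' D hadd).toIntLinearMap hmul

/-- `ℂ(x)` is a differential field with the derivation `d/dx`. -/
instance ratFuncDifferential : Differential (RatFunc ℂ) :=
  differentialOf ratDeriv ratDeriv_add ratDeriv_mul

/-- The sextic `x⁶ - 4 h x⁴ + 4 (h² - 1) x² + 4 k₁²`. -/
def sextic (h k₁ : ℂ) : ℂ[X] :=
  X ^ 6 - C (4 * h) * X ^ 4 + C (4 * (h ^ 2 - 1)) * X ^ 2 + C (4 * k₁ ^ 2)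

/-- The cubic `d₁ x³ - k₁`. -/
def cubic (d₁ k₁ : ℂ) : ℂ[X] := C d₁ * X ^ 3 - C k₁

/-- The coefficient `a(x)` of `u'` in the equation `u'' + a u' + b u = 0` of the Hess case. -/
def coeffA (d₁ h k₁ : ℂ) : RatFunc ℂ :=
  algebraMap ℂ[X] (RatFunc ℂ)
      (C d₁ * X ^ 9 - C (4 * k₁) * X ^ 6 - C (4 * d₁ * (h ^ 2 - 1)) * X ^ 5
        + C (12 * k₁ * h) * X ^ 4 - C (8 * k₁ ^ 2 * d₁) * X ^ 3
        - C (8 * k₁ * (h ^ 2 - 1)) * X ^ 2 - C (4 * k₁ ^ 3)) /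
    algebraMap ℂ[X] (RatFunc ℂ) (X * sextic h k₁ * cubic d₁ k₁)

/-- The coefficient `b(x)` of `u` in the equation `u'' + a u' + b u = 0` of the Hess case. -/
def coeffB (d₁ h k₁ : ℂ) : RatFunc ℂ :=
  algebraMap ℂ[X] (RatFunc ℂ) ((C d₁ * X ^ 3 + C k₁) * cubic d₁ k₁) /
    algebraMap ℂ[X] (RatFunc ℂ) (X ^ 2 * sextic h k₁)

/-- The function `R = a' / 2 + a² / 4 - b` of the reduced equation `y'' = R y`, which arises
from `u'' + a u' + b u = 0` by the substitution `y = u exp (½ ∫ a dx)`. -/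
def hessR (d₁ h k₁ : ℂ) : RatFunc ℂ :=
  (coeffA d₁ h k₁)′ / 2 + coeffA d₁ h k₁ ^ 2 / 4 - coeffB d₁ h k₁

/-- The equation `y'' = R y` has a liouvillian solution of type 1: a solution
`η = exp (∫ ω dx)` with `ω ∈ ℂ(x)`, i.e. a nonzero element `η` with `η' = ω η`
of some differential field extension of `ℂ(x)`. -/
def HasLiouvillianSolutionOfTypeOne (R : RatFunc ℂ) : Prop :=
  ∃ (F : Type u) (_ : Field F) (_ : Differential F) (_ : Algebra (RatFunc ℂ) F)
    (_ : DifferentialAlgebra (RatFunc ℂ) F) (ω : RatFunc ℂ) (η : F),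
    η ≠ 0 ∧ η′ = algebraMap (RatFunc ℂ) F ω * η ∧ η′′ = algebraMap (RatFunc ℂ) F R * η

end

end HessTop

namespace HessTop

open Polynomial

local notation "ι" => algebraMap ℂ[X] (RatFunc ℂ)

/-! Let `P` be the sextic, `k = k₁`. For `d₁ = 0` the coefficient `a` is the logarithmic derivative
of `x √P`, so with `D = x √P d/dx` the equation for `u` reads `D²u = k² u`, solved formally by `exp
(± k ∫ dx / (x √P))`. Let `v = u'/u` be rational. The first integral `(Du)² - k² u²` is constant, so
`N = P (x v)² - k²` satisfies `N' = -2 v N`; `N ≠ 0` because `P` has simple roots and `k²/P` is no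
square (`mul_sq_ne_const`). Then `W = 1 + 2 k² / N`, formally a hyperbolic cosine of twice the
argument, satisfies `4 k² (W² - 1) = (DW)² = x² P W'²`. Comparing pole orders leaves at most a
simple pole, at `0` (`denom_dvd_X`); comparing degrees then forces `W² = 1` (`sq_eq_X_sq`). Hence `v
= 0`, which is no solution since `k ≠ 0`. -/

theorem deriv_algebraMap_polynomial (p : ℂ[X]) : (ι p)′ = ι (derivative p) := by
  change ratDeriv (ι p) = _
  have := ratDeriv_div p 1 one_ne_zero
  simpa using this

theorem deriv_two : (2 : RatFunc ℂ)′ = 0 := by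
  have h := deriv_algebraMap_polynomial 2
  rwa [derivative_ofNat, map_zero, map_ofNat] at h

/-! ### Polynomials with simple roots -/

/-- A polynomial with distinct roots is not divisible by the square of a linear factor. -/
theorem not_isRoot_of_roots_nodup {P Q : ℂ[X]} (hP : P ≠ 0) (hn : P.roots.Nodup) {α : ℂ}
    (h : P = (X - C α) * Q) : Q.eval α ≠ 0 := by
  intro hQ
  obtain ⟨S, rfl⟩ := dvd_iff_isRoot.mpr hQ
  have h2 : 2 ≤ P.rootMultiplicity α :=
    (le_rootMultiplicity_iff hP).mpr ⟨S, by rw [h]; ring⟩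
  have := Multiset.nodup_iff_count_le_one.mp hn α
  rw [count_roots] at this
  omega

/-- A polynomial of positive degree with distinct roots is not, up to a constant, the square of a
rational function. -/
theorem mul_sq_ne_const {P : ℂ[X]} (hdeg : 0 < P.degree) (hn : P.roots.Nodup) {c : ℂ}
    (hc : c ≠ 0) (z : RatFunc ℂ) : ι P * z ^ 2 ≠ ι (C c) := by
  intro h
  have hP : P ≠ 0 := fun h0 => by simp [h0] at hdeg
  obtain ⟨α, hα⟩ := Complex.exists_root hdeg
  have hr := RatFunc.algebraMap_ne_zero z.denom_ne_zero
  have e : P * z.num ^ 2 = C c * z.denom ^ 2 := by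
    apply RatFunc.algebraMap_injective ℂ
    rw [← RatFunc.num_div_denom z] at h
    field_simp at h
    simpa [mul_comm] using h
  obtain ⟨Q, hQ⟩ := dvd_iff_isRoot.mpr hα
  have hqα : z.denom.eval α = 0 := by
    have := congrArg (eval α) e
    rw [IsRoot.def] at hα
    simpa [hα, hc] using this
  obtain ⟨r, hr'⟩ := dvd_iff_isRoot.mpr hqα
  -- The right side still vanishes at `α` while `Q` does not, so `α` is also a zero of the
  -- numerator, against coprimality.
  have e2 : Q * z.num ^ 2 = C c * (X - C α) * r ^ 2 := by
    apply mul_left_cancel₀ (X_sub_C_ne_zero α)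
    rw [hr', hQ] at e
    linear_combination e
  have h3 := congrArg (eval α) e2
  have h4 := not_isRoot_of_roots_nodup hP hn hQ
  have h5 : z.num.eval α = 0 := by simpa [h4] using h3
  obtain ⟨s, t, hst⟩ := z.isCoprime_num_denom
  have := congrArg (eval α) hst
  simp [h5, hqα] at this

/-! ### Poles and degree of rational solutions of `4 k² (W² - 1) = x² P W'²` -/

/-- Leibniz expansion of the Wronskian `f' g - f g'` at a zero of `g`. -/
theorem wronskian_factor (f G : ℂ[X]) (α : ℂ) (n : ℕ) :
    derivative f * ((X - C α) ^ (n + 1) * G) - f * derivative ((X - C α) ^ (n + 1) * G) =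
      (X - C α) ^ n * (derivative f * G * (X - C α) -
        f * ((n + 1 : ℂ[X]) * G + (X - C α) * derivative G)) := by
  simp only [derivative_mul, derivative_pow, derivative_sub, derivative_X, derivative_C]
  push_cast
  simp
  ring

/-- The equation `4 k² (f² - g²) G² (x - α)² = x² P (…)²` at a zero `α` of the denominator `g`. -/
theorem factored_equation {P f G : ℂ[X]} {k α : ℂ} {n : ℕ}
    (h : C (4 * k ^ 2) * (f ^ 2 - ((X - C α) ^ (n + 1) * G) ^ 2) *
        ((X - C α) ^ (n + 1) * G) ^ 2 =
      X ^ 2 * P * (derivative f * ((X - C α) ^ (n + 1) * G) -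
        f * derivative ((X - C α) ^ (n + 1) * G)) ^ 2) :
    C (4 * k ^ 2) * (f ^ 2 - ((X - C α) ^ (n + 1) * G) ^ 2) * G ^ 2 * (X - C α) ^ 2 =
      X ^ 2 * P * (derivative f * G * (X - C α) -
        f * ((n + 1 : ℂ[X]) * G + (X - C α) * derivative G)) ^ 2 := by
  rw [wronskian_factor] at h
  apply mul_left_cancel₀ (pow_ne_zero (2 * n) (X_sub_C_ne_zero α))
  linear_combination h

/-- The denominator of a solution of `4 k² (W² - 1) = x² P W'²` divides `x`. -/
theorem denom_dvd_X {P f g : ℂ[X]} {k : ℂ} (hP : P ≠ 0) (hn : P.roots.Nodup)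
    (hk : k ≠ 0) (hP0 : P.eval 0 = 4 * k ^ 2) (hg : g ≠ 0) (hfg : IsCoprime f g)
    (h : C (4 * k ^ 2) * (f ^ 2 - g ^ 2) * g ^ 2 =
      X ^ 2 * P * (derivative f * g - f * derivative g) ^ 2) : g ∣ X := by
  have hf : ∀ α, g.eval α = 0 → f.eval α ≠ 0 := by
    intro α hα h0
    obtain ⟨s, t, hst⟩ := hfg
    have := congrArg (eval α) hst
    simp [h0, hα] at this
  have key : ∀ α, g.eval α = 0 → ∃ (n : ℕ) (G : ℂ[X]), g = (X - C α) ^ (n + 1) * G ∧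
      G.eval α ≠ 0 := by
    intro α hα
    obtain ⟨G, hG, hnd⟩ := exists_eq_pow_rootMultiplicity_mul_and_not_dvd g hg α
    have hm : 0 < g.rootMultiplicity α := (rootMultiplicity_pos hg).mpr hα
    obtain ⟨n, hn⟩ := Nat.exists_eq_succ_of_ne_zero hm.ne'
    rw [hn] at hG
    exact ⟨n, G, hG, fun h0 => hnd (dvd_iff_isRoot.mpr h0)⟩
  have hcast : ∀ n : ℕ, (n + 1 : ℂ) ≠ 0 := fun n => by exact_mod_cast n.succ_ne_zero
  have zero_only : ∀ α, g.eval α = 0 → α = 0 := by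
    intro α hα
    by_contra hα0
    obtain ⟨n, G, hG, hGα⟩ := key α hα
    have hfα := hf α hα
    rw [hG] at h
    have e := factored_equation h
    -- The left side vanishes at `α`; on the right `α²` and the squared factor `((n + 1) f G)²` do
    -- not.
    have hPα : P.eval α = 0 := by
      have := congrArg (eval α) e
      simpa [hα0, hfα, hGα, hcast n] using this
    obtain ⟨Q, hQ⟩ := dvd_iff_isRoot.mpr hPα
    -- One factor `x - α` remains on the left after cancelling, so `Q` vanishes at `α` too and the
    -- root would be double.
    have e2 : C (4 * k ^ 2) * (f ^ 2 - ((X - C α) ^ (n + 1) * G) ^ 2) * G ^ 2 * (X - C α) =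
        X ^ 2 * Q * (derivative f * G * (X - C α) -
          f * ((n + 1 : ℂ[X]) * G + (X - C α) * derivative G)) ^ 2 := by
      apply mul_left_cancel₀ (X_sub_C_ne_zero α)
      rw [hQ] at e
      linear_combination e
    refine not_isRoot_of_roots_nodup hP hn hQ ?_
    have := congrArg (eval α) e2
    simpa [hα0, hfα, hGα, hcast n] using this
  by_cases h0 : g.eval 0 = 0
  · obtain ⟨n, G, hG, hG0⟩ := key 0 h0
    have hf0 := hf 0 h0
    have e := h
    rw [hG] at e
    have e := factored_equation e
    have e2 : C (4 * k ^ 2) * (f ^ 2 - ((X - C 0) ^ (n + 1) * G) ^ 2) * G ^ 2 =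
        P * (derivative f * G * (X - C 0) -
          f * ((n + 1 : ℂ[X]) * G + (X - C 0) * derivative G)) ^ 2 := by
      apply mul_left_cancel₀ (pow_ne_zero 2 (X_ne_zero (R := ℂ)))
      rw [C_0, sub_zero] at e ⊢
      linear_combination e
    have e3 := congrArg (eval 0) e2
    simp [hP0] at e3
    -- At `0` the pole orders agree, so leading coefficients decide: since `P(0) = 4 k²`, the pole
    -- order `n + 1` has square `1`.
    have e4 : (n + 1 : ℂ) ^ 2 = 1 := by
      have hne : 4 * k ^ 2 * f.eval 0 ^ 2 * G.eval 0 ^ 2 ≠ 0 :=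
        mul_ne_zero (mul_ne_zero (mul_ne_zero (by norm_num) (pow_ne_zero 2 hk))
          (pow_ne_zero 2 hf0)) (pow_ne_zero 2 hG0)
      apply mul_left_cancel₀ hne
      linear_combination -e3
    have hn0 : n = 0 := by
      have e5 : (n + 1) ^ 2 = 1 := by exact_mod_cast e4
      nlinarith
    subst hn0
    have hGu : IsUnit G := by
      by_contra hu
      have hdeg : G.degree ≠ 0 := fun hd => hu (isUnit_iff_degree_eq_zero.mpr hd)
      obtain ⟨β, hβ⟩ := IsAlgClosed.exists_root G hdeg
      have hβ0 : β = 0 := zero_only β (by rw [hG, eval_mul, hβ.eq_zero, mul_zero])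
      rw [hβ0] at hβ
      exact hG0 hβ
    rw [hG]
    simpa using hGu.mul_right_dvd.mpr dvd_rfl
  · have hu : IsUnit g := by
      by_contra hu
      have hdeg : g.degree ≠ 0 := fun hd => hu (isUnit_iff_degree_eq_zero.mpr hd)
      obtain ⟨β, hβ⟩ := IsAlgClosed.exists_root g hdeg
      rw [zero_only β hβ] at hβ
      exact h0 hβ
    exact hu.dvd

/-- Degrees exclude nonconstant solutions `W = f / x`. -/
theorem sq_eq_X_sq {P f : ℂ[X]} {c : ℂ} (hP : 2 < P.natDegree)
    (h : C c * (f ^ 2 - X ^ 2) = P * (derivative f * X - f) ^ 2) : 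
    C c * (f ^ 2 - X ^ 2) = 0 := by
  by_cases he : derivative f * X - f = 0
  · rw [h, he]; ring
  exfalso
  have hP0 : P ≠ 0 := fun h0 => by simp [h0] at hP
  have hd := congrArg natDegree h
  rw [natDegree_mul hP0 (pow_ne_zero 2 he), natDegree_pow] at hd
  have hle : (C c * (f ^ 2 - X ^ 2)).natDegree ≤ max (2 * f.natDegree) 2 := by
    refine (natDegree_C_mul_le _ _).trans ((natDegree_sub_le _ _).trans ?_)
    rw [natDegree_pow, natDegree_X_pow]
  by_cases h2 : 2 ≤ f.natDegree
  -- This coefficient is `deg f - 1` times the leading coefficient of `f`, so the right side has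
  -- degree at least `deg P + 2 deg f`.
  · have hc : (derivative f * X - f).coeff f.natDegree ≠ 0 := by
      obtain ⟨m, hm⟩ : ∃ m, f.natDegree = m + 1 := ⟨f.natDegree - 1, by omega⟩
      have hlc : f.coeff (m + 1) ≠ 0 := by
        rw [← hm]
        exact leadingCoeff_ne_zero.mpr (fun h0 => by simp [h0] at h2)
      rw [hm, coeff_sub, coeff_mul_X, coeff_derivative]
      have hm0 : (m : ℂ) ≠ 0 := by
        have : m ≠ 0 := by omega
        exact_mod_cast this
      have := mul_ne_zero hlc hm0
      convert this using 1
      ring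
    have := le_natDegree_of_ne_zero hc
    omega
  -- If `deg f ≤ 1`, the left side has degree at most `2 < deg P`.
  · omega

/-- All rational solutions of `4 k² (W² - 1) = x² P W'²` are `W = ±1`. -/
theorem sq_eq_one_of_equation {P : ℂ[X]} {k : ℂ} (hdeg : 2 < P.natDegree)
    (hn : P.roots.Nodup) (hk : k ≠ 0) (hP0 : P.eval 0 = 4 * k ^ 2) {W : RatFunc ℂ}
    (h : ι (C (4 * k ^ 2)) * (W ^ 2 - 1) = ι X ^ 2 * ι P * W′ ^ 2) : W ^ 2 = 1 := by
  have hP : P ≠ 0 := fun h0 => by simp [h0] at hdeg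
  have clear : ∀ f g : ℂ[X], g ≠ 0 → W = ι f / ι g →
      C (4 * k ^ 2) * (f ^ 2 - g ^ 2) * g ^ 2 =
        X ^ 2 * P * (derivative f * g - f * derivative g) ^ 2 := by
    intro f g hg hW
    have hg' := RatFunc.algebraMap_ne_zero hg
    have hd : W′ = ι (derivative f * g - f * derivative g) / ι g ^ 2 := by
      rw [hW]; exact ratDeriv_div f g hg
    rw [hd, hW] at h
    apply RatFunc.algebraMap_injective ℂ
    simp only [map_mul, map_sub, map_pow] at h ⊢
    field_simp at h
    linear_combination h
  have e := clear W.num W.denom W.denom_ne_zero (RatFunc.num_div_denom W).symm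
  obtain ⟨r, hr⟩ := denom_dvd_X hP hn hk hP0 W.denom_ne_zero W.isCoprime_num_denom e
  have hr0 : r ≠ 0 := by
    rintro rfl
    exact X_ne_zero (hr.trans (mul_zero _))
  have hW : W = ι (W.num * r) / ι X := by
    have h1 := RatFunc.algebraMap_ne_zero W.denom_ne_zero
    have h2 := RatFunc.algebraMap_ne_zero hr0
    conv_lhs => rw [← RatFunc.num_div_denom W]
    rw [hr, map_mul, map_mul, mul_div_mul_right _ _ h2]
  have e2 := clear _ X X_ne_zero hW
  have e3 : C (4 * k ^ 2) * ((W.num * r) ^ 2 - X ^ 2) =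
      P * (derivative (W.num * r) * X - W.num * r) ^ 2 := by
    apply mul_left_cancel₀ (pow_ne_zero 2 (X_ne_zero (R := ℂ)))
    rw [derivative_X, mul_one] at e2
    linear_combination e2
  have e4 := sq_eq_X_sq hdeg e3
  have e5 : (W.num * r) ^ 2 = X ^ 2 := by
    rcases mul_eq_zero.mp e4 with h0 | h0
    · exact absurd (C_eq_zero.mp h0) (mul_ne_zero (by norm_num) (pow_ne_zero 2 hk))
    · exact sub_eq_zero.mp h0
  rw [hW, div_pow, ← map_pow, e5, map_pow]
  exact div_self (pow_ne_zero 2 (RatFunc.algebraMap_ne_zero X_ne_zero))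

/-! ### The Riccati equation -/

/-- The Riccati equation of `u'' + (1/x + P'/(2P)) u' - k²/(x² P) u = 0` has no rational
solution. -/
theorem no_rational_riccati_solution {P : ℂ[X]} {k : ℂ} (hdeg : 2 < P.natDegree)
    (hn : P.roots.Nodup) (hk : k ≠ 0) (hP0 : P.eval 0 = 4 * k ^ 2) (v : RatFunc ℂ)
    (h : v′ + v ^ 2 + (1 / ι X + ι (derivative P) / (2 * ι P)) * v -
      ι (C k) ^ 2 / (ι X ^ 2 * ι P) = 0) : False := by
  have hP : P ≠ 0 := fun h0 => by simp [h0] at hdeg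
  have hιP := RatFunc.algebraMap_ne_zero hP
  have hx : ι X ≠ 0 := RatFunc.algebraMap_ne_zero X_ne_zero
  have hκ : ι (C k) ≠ 0 := RatFunc.algebraMap_ne_zero (C_ne_zero.mpr hk)
  have dx : (ι X)′ = 1 := by rw [deriv_algebraMap_polynomial, derivative_X, map_one]
  have dP := deriv_algebraMap_polynomial P
  have dκ : (ι (C k))′ = 0 := by rw [deriv_algebraMap_polynomial, derivative_C, map_zero]
  have hC : ι (C (4 * k ^ 2)) = 4 * ι (C k) ^ 2 := by
    rw [C_mul, C_pow, C_ofNat, map_mul, map_pow, map_ofNat]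
  obtain ⟨N, hN⟩ : ∃ N, N = ι P * (ι X * v) ^ 2 - ι (C k) ^ 2 := ⟨_, rfl⟩
  have hN0 : N ≠ 0 := by
    intro h0
    refine mul_sq_ne_const (natDegree_pos_iff_degree_pos.mp (by omega)) hn
      (pow_ne_zero 2 hk) (ι X * v) ?_
    rw [map_pow, map_pow]
    exact sub_eq_zero.mp (hN.symm.trans h0)
  have dN : N′ = -2 * v * N := by
    have hv : v′ = ι (C k) ^ 2 / (ι X ^ 2 * ι P) - v ^ 2 -
        (1 / ι X + ι (derivative P) / (2 * ι P)) * v := by linear_combination h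
    rw [hN]
    simp only [map_sub, Derivation.leibniz, Derivation.leibniz_pow, smul_eq_mul, nsmul_eq_mul, dx,
      dP, dκ, hv]
    push_cast
    field_simp
    ring
  obtain ⟨W, hW⟩ : ∃ W, W = 1 + 2 * ι (C k) ^ 2 / N := ⟨_, rfl⟩
  have dW : W′ = 4 * ι (C k) ^ 2 * v / N := by
    have hWN : W * N = N + 2 * ι (C k) ^ 2 := by rw [hW]; field_simp
    have := congrArg (fun t => t′) hWN
    simp only [map_add, Derivation.leibniz, Derivation.leibniz_pow, smul_eq_mul, dκ, dN, deriv_two] at this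
    rw [eq_div_iff hN0]
    simp only [mul_zero, smul_zero, add_zero] at this
    linear_combination this + 2 * v * hWN
  have hsq : W ^ 2 = 1 := by
    refine sq_eq_one_of_equation hdeg hn hk hP0 ?_
    rw [hC, dW, hW]
    field_simp
    rw [hN]
    ring
  -- `N² (W² - 1) = 4 k² (N + k²) = 4 k² P (x v)²`.
  have hv0 : v = 0 := by
    have h2 : 4 * ι (C k) ^ 2 * (ι P * (ι X * v) ^ 2) = 0 := by
      have hWN : W * N = N + 2 * ι (C k) ^ 2 := by rw [hW]; field_simp
      linear_combination (-(W * N) - N - 2 * ι (C k) ^ 2) * hWN + N ^ 2 * hsq -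
        4 * ι (C k) ^ 2 * hN
    have h3 : ι P * (ι X * v) ^ 2 = 0 :=
      (mul_eq_zero.mp h2).resolve_left (mul_ne_zero (by norm_num) (pow_ne_zero 2 hκ))
    have h4 := eq_zero_of_pow_eq_zero ((mul_eq_zero.mp h3).resolve_left hιP)
    exact (mul_eq_zero.mp h4).resolve_left hx
  rw [hv0] at h
  have h5 : ι (C k) ^ 2 / (ι X ^ 2 * ι P) ≠ 0 :=
    div_ne_zero (pow_ne_zero 2 hκ) (mul_ne_zero (pow_ne_zero 2 hx) hιP)
  apply h5
  rw [map_zero] at h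
  linear_combination -h

/-! ### The Hess equation in the Lagrange case -/

theorem sextic_natDegree (h k : ℂ) : (sextic h k).natDegree = 6 := by
  unfold sextic
  compute_degree!

theorem coeffA_zero (h : ℂ) {k : ℂ} (hk : k ≠ 0) :
    coeffA 0 h k = 1 / ι X + ι (derivative (sextic h k)) / (2 * ι (sextic h k)) := by
  have hP : sextic h k ≠ 0 := fun h0 => by simpa [h0] using sextic_natDegree h k
  have hιP := RatFunc.algebraMap_ne_zero hP
  have hx : ι X ≠ 0 := RatFunc.algebraMap_ne_zero X_ne_zero
  have hκ : ι (C k) ≠ 0 := RatFunc.algebraMap_ne_zero (C_ne_zero.mpr hk)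
  -- Twice the numerator of `a` is `-k (2 P + x P')`; the factor `-k` cancels against the cubic,
  -- which is `-k` here.
  have e : (C 0 * X ^ 9 - C (4 * k) * X ^ 6 - C (4 * 0 * (h ^ 2 - 1)) * X ^ 5
        + C (12 * k * h) * X ^ 4 - C (8 * k ^ 2 * 0) * X ^ 3
        - C (8 * k * (h ^ 2 - 1)) * X ^ 2 - C (4 * k ^ 3)) * 2 =
      -C k * (2 * sextic h k + X * derivative (sextic h k)) := by
    unfold sextic
    simp only [derivative_add, derivative_sub, derivative_C_mul, derivative_X_pow, derivative_C]
    simp only [map_mul, map_sub, map_pow, map_one, map_zero, C_ofNat]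
    push_cast
    simp only [C_ofNat]
    ring
  have e' := congrArg ι e
  have hc : cubic 0 k = -C k := by simp [cubic]
  rw [coeffA, hc]
  rw [map_mul _ _ 2] at e'
  rw [map_mul _ _ (-C k), map_mul _ X]
  have h2 : ι 2 = 2 := map_ofNat _ 2
  rw [h2] at e'
  rw [div_add_div _ _ hx (mul_ne_zero two_ne_zero hιP), div_eq_div_iff
    (mul_ne_zero (mul_ne_zero hx hιP) (by rwa [map_neg, neg_ne_zero]))
    (mul_ne_zero hx (mul_ne_zero two_ne_zero hιP))]
  simp only [map_mul _ (-C k), map_neg, map_add, map_mul ι 2, map_mul ι X, h2] at e' ⊢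
  linear_combination (ι X * ι (sextic h k)) * e'

theorem coeffB_zero (h k : ℂ) :
    coeffB 0 h k = -(ι (C k) ^ 2 / (ι X ^ 2 * ι (sextic h k))) := by
  simp only [coeffB, cubic, map_mul, map_zero, zero_mul, zero_add, zero_sub, map_neg, map_pow]
  ring

theorem no_riccati_solution_hessR_zero {h k : ℂ} (hn : (sextic h k).roots.Nodup) (hk : k ≠ 0) :
    ¬ ∃ ω : RatFunc ℂ, ω′ + ω ^ 2 = hessR 0 h k := by
  rintro ⟨ω, hω⟩
  -- The substitution `y = u exp (½ ∫ a dx)` shifts logarithmic derivatives by `a / 2`.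
  refine no_rational_riccati_solution (by rw [sextic_natDegree]; norm_num) hn hk
    (by simp [sextic]) (ω - coeffA 0 h k / 2) ?_
  have dhalf : (coeffA 0 h k / 2)′ = (coeffA 0 h k)′ / 2 := by
    have e : coeffA 0 h k / 2 * 2 = coeffA 0 h k := by field_simp
    have := congrArg (fun t => t′) e
    simp only [Derivation.leibniz, smul_eq_mul, deriv_two] at this
    rw [eq_div_iff two_ne_zero]
    linear_combination this
  have hB := coeffB_zero h k
  rw [← coeffA_zero h hk, map_sub, dhalf]
  rw [hessR] at hω
  linear_combination hω - hB

/-- A solution of type 1 gives a rational solution of the Riccati equation. -/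
theorem HasLiouvillianSolutionOfTypeOne.exists_riccati {R : RatFunc ℂ}
    (h : HasLiouvillianSolutionOfTypeOne.{u} R) : ∃ ω : RatFunc ℂ, ω′ + ω ^ 2 = R := by
  obtain ⟨F, _, _, _, _, ω, η, hη, h1, h2⟩ := h
  refine ⟨ω, (algebraMap (RatFunc ℂ) F).injective ?_⟩
  apply mul_right_cancel₀ hη
  rw [← h2, h1, Derivation.leibniz, h1, DifferentialAlgebra.deriv_algebraMap]
  simp only [map_add, map_pow, smul_eq_mul]
  ring

end HessTop

theorem theorem4 (d₁ h k₁ : ℝ)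
    (hroots : (HessTop.sextic (h : ℂ) (k₁ : ℂ)).roots.Nodup)
    (hd₁ : d₁ = 0) (hk₁ : k₁ ≠ 0) :
    ¬ HessTop.HasLiouvillianSolutionOfTypeOne.{u} (HessTop.hessR (d₁ : ℂ) (h : ℂ) (k₁ : ℂ)) ∧
      ¬ ∃ ω : RatFunc ℂ,
        ω′ + ω ^ 2 = HessTop.hessR (d₁ : ℂ) (h : ℂ) (k₁ : ℂ) := by
  subst hd₁
  have key := HessTop.no_riccati_solution_hessR_zero hroots (Complex.ofReal_ne_zero.mpr hk₁)
  rw [Complex.ofReal_zero]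
  exact ⟨fun hL => key hL.exists_riccati, key⟩
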